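/- Graphs are finite, simple and non-empty. A graph is chordal if every cycle of length at least $4$ has a chord. Let $M_1$ be the pattern with rows $(0,\ast,\ast)$, $(\ast,0,1)$, $(\ast,1,0)$; thus an $M_1$-partition of a graph $G$ is a partition of its vertex set into three (possibly empty) independent sets $V_1,V_2,V_3$ such that every vertex of $V_2$ is adjacent to every vertex of $V_3$. For a set $\mathcal S$ of graphs, $G$ is $\mathcal S$-free if no member of $\mathcal S$ is isomorphic to an induced subgraph of $G$. Define the following graphs. - $F_1$ is the disjoint union $K_3+K_2$. - $F_2$ is the triangle with one pendant vertex attached to each of its three vertices (the net). - $F_3$ is the graph on seven vertices obtained from a triangle by attaching a pendant path with two edges at each of two of its vertices. - $F_4$ is the graph on seven vertices obtained from a path $a\,b\,c\,d$ by adding a vertex adjacent to all of $a,b,c,d$, a pendant vertex attached to $b$, and a pendant vertex attached to $c$. - $\mathcal F_1$ is the set of all graphs obtained from a path with $\ell$ edges, $\ell\ge 5$ odd, by adding one vertex adjacent to every vertex of the path except its first and last vertices. Theorem. Let $G$ be a chordal graph. Then $G$ admits an $M_1$-partition if and only if $G$ is $(\{F_1,F_2,F_3,F_4\}\cup\mathcal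 F_1)$-free and there exists a vertex $v_0$ of $G$ such that $G-v_0$ is bipartite. -/

import Mathlib

open scoped SimpleGraph

/-- The three kinds of entries `0`, `1`, `∗` of a pattern. -/
inductive PatternEntry where
  | zero
  | one
  | star

/-- `part` assigns to each vertex `v` the index of the part containing it (so the part `V_i` is
`part ⁻¹' {i}`; parts may be empty). This is an `M`-partition if, for all `i`, `j` (possibly equal)
and all distinct `u ∈ V_i`, `v ∈ V_j`, the vertices `u` and `v` are adjacent when `M i j = 1` and
non-adjacent when `M i j = 0`. -/
def IsMatrixPartition {V : Type*} {m : ℕ} (M : Matrix (Fin m) (Fin m) PatternEntry)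
    (G : SimpleGraph V) (part : V → Fin m) : Prop :=
  ∀ u v : V, u ≠ v →
    (M (part u) (part v) = PatternEntry.one → G.Adj u v) ∧
    (M (part u) (part v) = PatternEntry.zero → ¬ G.Adj u v)

/-- `G` admits an `M`-partition. -/
def AdmitsMatrixPartition {V : Type*} {m : ℕ} (M : Matrix (Fin m) (Fin m) PatternEntry)
    (G : SimpleGraph V) : Prop :=
  ∃ part : V → Fin m, IsMatrixPartition M G part

open PatternEntry in
/-- The pattern with rows `(0, ∗, ∗)`, `(∗, 0, 1)`, `(∗, 1, 0)`. -/
def patternM₁ : Matrix (Fin 3) (Fin 3) PatternEntry :=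
  !![zero, star, star;
     star, zero, one;
     star, one, zero]

/-- A graph is chordal if every cycle of length at least four has a chord. -/
def IsChordalGraph {V : Type*} (G : SimpleGraph V) : Prop :=
  ∀ (v : V) (c : G.Walk v v), c.IsCycle → 4 ≤ c.length → ∃ e, c.IsChord e

/-- `G` contains no member of the set `S` of graphs as an induced subgraph. -/
def IsInducedFree {V : Type*} (S : Set (Σ W : Type, SimpleGraph W)) (G : SimpleGraph V) : Prop :=
  ∀ H ∈ S, ¬ H.2 ⊴ G

/-- The disjoint union of a triangle and an edge. -/
def graphF₁ : SimpleGraph (Fin 5) :=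
  SimpleGraph.fromEdgeSet {s(0, 1), s(0, 2), s(1, 2), s(3, 4)}

/-- The net: a triangle with one pendant vertex attached to each of its vertices. -/
def graphF₂ : SimpleGraph (Fin 6) :=
  SimpleGraph.fromEdgeSet {s(0, 1), s(0, 2), s(1, 2), s(0, 3), s(1, 4), s(2, 5)}

/-- A triangle `0, 1, 2` with a pendant path `1, 3, 4` attached at `1` and a pendant path
`2, 5, 6` attached at `2`. -/
def graphF₃ : SimpleGraph (Fin 7) :=
  SimpleGraph.fromEdgeSet
    {s(0, 1), s(0, 2), s(1, 2), s(1, 3), s(3, 4), s(2, 5), s(5, 6)}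

/-- The path `6, 1, 2, 5`, a vertex `0` adjacent to all four of its vertices, and pendant vertices
`3` and `4` attached to the inner vertices `1` and `2` of the path, respectively. -/
def graphF₄ : SimpleGraph (Fin 7) :=
  SimpleGraph.fromEdgeSet
    {s(6, 1), s(1, 2), s(2, 5), s(0, 6), s(0, 1), s(0, 2), s(0, 5), s(1, 3), s(2, 4)}

/-- The path with `ℓ` edges (on the vertices `some 0, …, some ℓ`), together with an additional
vertex `none` adjacent to every vertex of the path except the first and the last. -/
def pathWithHub (ℓ : ℕ) : SimpleGraph (Option (Fin (ℓ + 1))) :=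
  SimpleGraph.fromRel fun
    | some i, some j => (SimpleGraph.pathGraph (ℓ + 1)).Adj i j
    | none, some i => i ≠ 0 ∧ i ≠ Fin.last ℓ
    | _, none => False

/-- The family of the graphs `pathWithHub ℓ` for odd `ℓ ≥ 5`. -/
def familyF₁ : Set (Σ W : Type, SimpleGraph W) :=
  {H | ∃ ℓ : ℕ, Odd ℓ ∧ 5 ≤ ℓ ∧ H = ⟨Option (Fin (ℓ + 1)), pathWithHub ℓ⟩}

/-- The set `{F₁, F₂, F₃, F₄}`. -/
def sporadicF : Set (Σ W : Type, SimpleGraph W) :=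
  {⟨Fin 5, graphF₁⟩, ⟨Fin 6, graphF₂⟩, ⟨Fin 7, graphF₃⟩, ⟨Fin 7, graphF₄⟩}

/-! Necessity. Having an `M₁`-partition passes to induced subgraphs, and each forbidden graph is
checked by hand to have none. If `V₂` and `V₃` both had two vertices, these would induce a 4-cycle;
so by chordality one of them has at most one vertex, and deleting it leaves two independent sets.

Sufficiency. Suppose that no partition exists. If `G - v` is bipartite, then `v` lies in every
triangle; conversely, if `v` lies in every triangle of a chordal graph, then `G - v` is acyclic,
hence bipartite. For such `v`, try to make `{v}` a part: this succeeds unless some component of `G -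
v` has non-neighbours of `v` in both colours. A closest such pair is joined by an induced path of
odd length with all inner vertices adjacent to `v`. Length at least 5 is excluded by the family, so
length 1 or 3 remains, and `v` is obstructed (`isObstructed_of_not_admits`).

So every vertex meeting all triangles is obstructed, and `not_forall_isObstructed` refutes this. One
obstruction yields a second vertex meeting all triangles, adjacent to the first
(`exists_adj_coversTriangles`). The obstructions at the vertices meeting all triangles then attach
private neighbours or pendant paths to a common triangle, which creates a net or `F₃`. -/

/-! ### Chords of short cycles; triangles in chordal graphs -/

namespace IsChordalGraph

variable {V : Type*} {G : SimpleGraph V}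

theorem chord_of_cycle_four (hG : IsChordalGraph G) {a b c d : V} (hab : G.Adj a b)
    (hbc : G.Adj b c) (hcd : G.Adj c d) (hda : G.Adj d a) (hac : a ≠ c) (hbd : b ≠ d) :
    G.Adj a c ∨ G.Adj b d := by
  have h1 := hab.ne
  have h2 := hbc.ne
  have h3 := hcd.ne
  have h4 := hda.ne
  obtain ⟨e, he⟩ := hG a (.cons hab (.cons hbc (.cons hcd (.cons hda .nil)))) (by
    simp [SimpleGraph.Walk.cons_isCycle_iff, SimpleGraph.Walk.cons_isPath_iff]; grind) (by simp)
  induction e with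
  | _ x y =>
    simp only [SimpleGraph.Walk.isChord_sym2Mk, SimpleGraph.Walk.edges_cons,
      SimpleGraph.Walk.support_cons, SimpleGraph.Walk.edges_nil, SimpleGraph.Walk.support_nil,
      List.mem_cons, List.not_mem_nil, Sym2.eq_iff, or_false] at he
    grind (splits := 20) [SimpleGraph.adj_comm, SimpleGraph.irrefl]

theorem chord_of_cycle_five (hG : IsChordalGraph G) {a b c d e : V} (hab : G.Adj a b)
    (hbc : G.Adj b c) (hcd : G.Adj c d) (hde : G.Adj d e) (hea : G.Adj e a)
    (hac : a ≠ c) (had : a ≠ d) (hbd : b ≠ d) (hbe : b ≠ e) (hce : c ≠ e) :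
    G.Adj a c ∨ G.Adj a d ∨ G.Adj b d ∨ G.Adj b e ∨ G.Adj c e := by
  have h1 := hab.ne
  have h2 := hbc.ne
  have h3 := hcd.ne
  have h4 := hde.ne
  have h5 := hea.ne
  obtain ⟨f, hf⟩ := hG a (.cons hab (.cons hbc (.cons hcd (.cons hde (.cons hea .nil))))) (by
    simp [SimpleGraph.Walk.cons_isCycle_iff, SimpleGraph.Walk.cons_isPath_iff]; grind) (by simp)
  induction f with
  | _ x y =>
    simp only [SimpleGraph.Walk.isChord_sym2Mk, SimpleGraph.Walk.edges_cons,
      SimpleGraph.Walk.support_cons, SimpleGraph.Walk.edges_nil, SimpleGraph.Walk.support_nil,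
      List.mem_cons, List.not_mem_nil, Sym2.eq_iff, or_false] at hf
    grind (splits := 20) [SimpleGraph.adj_comm, SimpleGraph.irrefl]

theorem chord_of_cycle_six (hG : IsChordalGraph G) {a b c d e f : V} (hab : G.Adj a b)
    (hbc : G.Adj b c) (hcd : G.Adj c d) (hde : G.Adj d e) (hef : G.Adj e f) (hfa : G.Adj f a)
    (hac : a ≠ c) (had : a ≠ d) (hae : a ≠ e) (hbd : b ≠ d) (hbe : b ≠ e) (hbf : b ≠ f)
    (hce : c ≠ e) (hcf : c ≠ f) (hdf : d ≠ f) :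
    G.Adj a c ∨ G.Adj a d ∨ G.Adj a e ∨ G.Adj b d ∨ G.Adj b e ∨ G.Adj b f ∨ G.Adj c e ∨
      G.Adj c f ∨ G.Adj d f := by
  have h1 := hab.ne
  have h2 := hbc.ne
  have h3 := hcd.ne
  have h4 := hde.ne
  have h5 := hef.ne
  have h6 := hfa.ne
  obtain ⟨g, hg⟩ := hG a
    (.cons hab (.cons hbc (.cons hcd (.cons hde (.cons hef (.cons hfa .nil)))))) (by
    simp [SimpleGraph.Walk.cons_isCycle_iff, SimpleGraph.Walk.cons_isPath_iff]; grind) (by simp)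
  induction g with
  | _ x y =>
    simp only [SimpleGraph.Walk.isChord_sym2Mk, SimpleGraph.Walk.edges_cons,
      SimpleGraph.Walk.support_cons, SimpleGraph.Walk.edges_nil, SimpleGraph.Walk.support_nil,
      List.mem_cons, List.not_mem_nil, Sym2.eq_iff, or_false] at hg
    grind (splits := 20) [SimpleGraph.adj_comm, SimpleGraph.irrefl]

/-- Every cycle of a chordal graph spans a triangle. -/
theorem exists_triangle_of_isCycle (hG : IsChordalGraph G) {v : V} (c : G.Walk v v)
    (hc : c.IsCycle) :
    ∃ x ∈ c.support, ∃ y ∈ c.support, ∃ z ∈ c.support, G.Adj x y ∧ G.Adj y z ∧ G.Adj z x := by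
  classical
  induction hn : c.length using Nat.strong_induction_on generalizing v with
  | _ n ih =>
  subst hn
  by_cases h4 : 4 ≤ c.length
  · obtain ⟨e, he⟩ := hG v c hc h4
    induction e with
    | _ u w =>
      rw [SimpleGraph.Walk.isChord_sym2Mk] at he
      obtain ⟨huw, hne, hu, hw⟩ := he
      have hc' := hc.rotate hu
      have hw' : w ∈ (c.rotate u hu).support := by
        rwa [SimpleGraph.Walk.mem_support_rotate_iff c u hu]
      have hp := hc'.isPath_takeUntil hw'
      have hsub : ∀ x ∈ ((c.rotate u hu).takeUntil w hw').support, x ∈ c.support := by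
        intro x hx
        rw [← SimpleGraph.Walk.mem_support_rotate_iff c u hu]
        exact SimpleGraph.Walk.support_takeUntil_subset_support _ _ hx
      -- A chord is not an edge of the cycle, so the complementary arc has at least two edges;
      -- replacing that arc by the chord gives a shorter cycle.
      have hne' : s(w, u) ∉ (c.rotate u hu).edges := by
        rw [(c.rotate_edges u hu).mem_iff, Sym2.eq_swap]
        exact hne
      have hcyc : (SimpleGraph.Walk.cons huw.symm
          ((c.rotate u hu).takeUntil w hw')).IsCycle := by
        rw [SimpleGraph.Walk.cons_isCycle_iff]
        exact ⟨hp, fun h => hne' (SimpleGraph.Walk.edges_takeUntil_subset_edges _ _ h)⟩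
      have hlen : (SimpleGraph.Walk.cons huw.symm
          ((c.rotate u hu).takeUntil w hw')).length < c.length := by
        have h1 := congrArg SimpleGraph.Walk.length ((c.rotate u hu).take_spec hw')
        have h2 : 2 ≤ ((c.rotate u hu).dropUntil w hw').length := by
          by_contra hlt
          have hd : ∀ q : G.Walk w u, q.length < 2 → s(w, u) ∈ q.edges := by
            intro q hq
            cases q with
            | nil => exact absurd rfl huw.ne
            | cons h q =>
              cases q with
              | nil => simp
              | cons h' q => simp at hq
          exact hne' (SimpleGraph.Walk.edges_dropUntil_subset_edges _ _ (hd _ (by omega)))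
        simp only [SimpleGraph.Walk.length_append, SimpleGraph.Walk.length_rotate] at h1
        simp only [SimpleGraph.Walk.length_cons]
        omega
      obtain ⟨x, hx, y, hy, z, hz, h⟩ := ih _ hlen _ hcyc rfl
      have hsup : ∀ x ∈ (SimpleGraph.Walk.cons huw.symm
          ((c.rotate u hu).takeUntil w hw')).support, x ∈ c.support := by
        intro x hx
        rw [SimpleGraph.Walk.support_cons, List.mem_cons] at hx
        rcases hx with rfl | hx
        · exact hw
        · exact hsub x hx
      exact ⟨x, hsup x hx, y, hsup y hy, z, hsup z hz, h⟩
  · have h3 : c.length = 3 := by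
      have := hc.three_le_length
      omega
    have h0 := c.adj_getVert_succ (i := 0) (by omega)
    have h1 := c.adj_getVert_succ (i := 1) (by omega)
    have h2 := c.adj_getVert_succ (i := 2) (by omega)
    have h30 : c.getVert (2 + 1) = c.getVert 0 := by
      rw [SimpleGraph.Walk.getVert_zero, c.getVert_of_length_le (by omega)]
    rw [h30] at h2
    exact ⟨_, c.getVert_mem_support 0, _, c.getVert_mem_support 1, _, c.getVert_mem_support 2,
      h0, h1, h2⟩

/-- If all triangles of a chordal graph contain a vertex, then removing it leaves a bipartite
graph. -/
theorem isBipartite_induce_compl (hG : IsChordalGraph G) {v : V}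
    (hv : ∀ x y z, G.Adj x y → G.Adj y z → G.Adj z x → v = x ∨ v = y ∨ v = z) :
    (G.induce {v}ᶜ).IsBipartite := by
  apply SimpleGraph.IsAcyclic.isBipartite
  intro u c hc
  have hinj : Function.Injective (SimpleGraph.Embedding.induce (G := G) {v}ᶜ).toHom :=
    (SimpleGraph.Embedding.induce (G := G) {v}ᶜ).injective
  obtain ⟨x, hx, y, hy, z, hz, h1, h2, h3⟩ :=
    hG.exists_triangle_of_isCycle _ ((SimpleGraph.Walk.isCycle_map_iff_of_injective hinj).2 hc)
  have hmem : ∀ x ∈ (c.map (SimpleGraph.Embedding.induce (G := G) {v}ᶜ).toHom).support,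
      v ≠ x := by
    intro x hx
    rw [SimpleGraph.Walk.support_map, List.mem_map] at hx
    obtain ⟨a, -, rfl⟩ := hx
    exact fun h => a.2 h.symm
  rcases hv x y z h1 h2 h3 with h | h | h
  exacts [hmem x hx h, hmem y hy h, hmem z hz h]

end IsChordalGraph

/-! ### Geodesics are induced paths; adjacency in the hub graphs -/

theorem SimpleGraph.Walk.dist_getVert_of_length_eq_dist {V : Type*} {G : SimpleGraph V} {u w : V}
    (p : G.Walk u w) (hp : p.length = G.dist u w) {i j : ℕ} (hij : i ≤ j) (hj : j ≤ p.length) :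
    G.dist (p.getVert i) (p.getVert j) = j - i := by
  have h := SimpleGraph.length_eq_dist_of_subwalk hp
    (((p.take j).isSubwalk_drop i).trans (p.isSubwalk_take j))
  have h' : (p.take j).getVert i = p.getVert i := by
    rw [SimpleGraph.Walk.take_getVert, min_eq_right hij]
  rw [← h', ← h, SimpleGraph.Walk.drop_length, SimpleGraph.Walk.take_length, min_eq_left hj]

theorem SimpleGraph.Walk.adj_getVert_iff_of_length_eq_dist {V : Type*} {G : SimpleGraph V}
    {u w : V} (p : G.Walk u w) (hp : p.length = G.dist u w) {i j : ℕ} (hi : i ≤ p.length)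
    (hj : j ≤ p.length) :
    G.Adj (p.getVert i) (p.getVert j) ↔ i + 1 = j ∨ j + 1 = i := by
  rw [← SimpleGraph.dist_eq_one_iff_adj]
  rcases le_total i j with h | h
  · rw [p.dist_getVert_of_length_eq_dist hp h hj]
    omega
  · rw [SimpleGraph.dist_comm, p.dist_getVert_of_length_eq_dist hp h hi]
    omega

theorem pathWithHub_adj_some {ℓ : ℕ} (i j : Fin (ℓ + 1)) :
    (pathWithHub ℓ).Adj (some i) (some j) ↔ i.val + 1 = j ∨ j.val + 1 = i := by
  simp only [pathWithHub, SimpleGraph.fromRel_adj, SimpleGraph.pathGraph_adj, ne_eq,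
    Option.some.injEq, Fin.ext_iff]
  omega

theorem pathWithHub_adj_none {ℓ : ℕ} (i : Fin (ℓ + 1)) :
    (pathWithHub ℓ).Adj none (some i) ↔ 0 < i.val ∧ i.val < ℓ := by
  simp only [pathWithHub, SimpleGraph.fromRel_adj, ne_eq, reduceCtorEq, not_false_eq_true,
    true_and, or_false, Fin.ext_iff, Fin.val_zero, Fin.val_last]
  have := i.2
  omega

/-! ### Obstructions to making a single vertex a part -/

section

variable {V : Type*} {G : SimpleGraph V}

/-- There are two adjacent vertices outside the closed neighbourhood of `v`, or a walk `x, a, b, y`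
avoiding `v` whose inner vertices are neighbours of `v` while its ends are not. Either of these
precludes an `M₁`-partition in which `v` forms a part. -/
def SimpleGraph.IsObstructed (G : SimpleGraph V) (v : V) : Prop :=
  (∃ x y, x ≠ v ∧ y ≠ v ∧ G.Adj x y ∧ ¬ G.Adj v x ∧ ¬ G.Adj v y) ∨
    ∃ x a b y, x ≠ v ∧ y ≠ v ∧ G.Adj x a ∧ G.Adj a b ∧ G.Adj b y ∧ G.Adj v a ∧ G.Adj v b ∧
      ¬ G.Adj v x ∧ ¬ G.Adj v y

/-- With `V₃ = {v}`, all that is needed is a proper 2-colouring of `G - v` in which every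
non-neighbour of `v` gets the colour of `V₁`. The two colours may be swapped on each component
separately, so agreement within components suffices. -/
theorem admitsMatrixPartition_of_coloring {v : V} (C : (G.induce {v}ᶜ).Coloring Bool)
    (h : ∀ u w : ({v}ᶜ : Set V), (G.induce {v}ᶜ).Reachable u w → ¬ G.Adj v u → ¬ G.Adj v w →
      C u = C w) :
    AdmitsMatrixPartition patternM₁ G := by
  classical
  -- The components to be swapped: those with a non-neighbour of `v` in the colour meant for `V₂`.
  let flip : ({v}ᶜ : Set V) → Prop := fun u =>
    ∃ w, (G.induce {v}ᶜ).Reachable u w ∧ ¬ G.Adj v w ∧ C w = true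
  have hflip : ∀ u w, (G.induce {v}ᶜ).Adj u w → (flip u ↔ flip w) := by
    intro u w huw
    exact ⟨fun ⟨z, hz, hz'⟩ => ⟨z, huw.symm.reachable.trans hz, hz'⟩,
      fun ⟨z, hz, hz'⟩ => ⟨z, huw.reachable.trans hz, hz'⟩⟩
  let col : ({v}ᶜ : Set V) → Bool := fun u => if flip u then !(C u) else C u
  have hcol : ∀ u w, (G.induce {v}ᶜ).Adj u w → col u ≠ col w := by
    intro u w huw
    have h1 := C.valid huw
    have h2 := hflip u w huw
    by_cases h3 : flip u <;> simp only [col, ← h2, h3, if_true, if_false] <;> simpa using h1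
  have hnon : ∀ u : ({v}ᶜ : Set V), ¬ G.Adj v u → col u = false := by
    intro u hu
    by_cases h3 : flip u
    · obtain ⟨w, hw, hw', hc⟩ := id h3
      simp [col, h3, h u w hw hu hw', hc]
    · have : C u ≠ true := fun hc => h3 ⟨u, .refl _, hu, hc⟩
      simpa [col, h3] using this
  refine ⟨fun u => if hu : u = v then 2 else if col ⟨u, hu⟩ then 1 else 0, ?_⟩
  intro u w huw
  by_cases hu : u = v
  · subst hu
    have hw : w ≠ u := huw.symm
    have h1 := hnon ⟨w, hw⟩
    by_cases h2 : col ⟨w, hw⟩ = true <;> simp_all [patternM₁]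
  · by_cases hw : w = v
    · subst hw
      have h1 := hnon ⟨u, hu⟩
      rw [SimpleGraph.adj_comm] at h1
      by_cases h2 : col ⟨u, hu⟩ = true <;> simp_all [patternM₁]
    · have h1 := hcol ⟨u, hu⟩ ⟨w, hw⟩
      simp only [SimpleGraph.comap_adj, Function.Embedding.subtype_apply] at h1
      by_cases h2 : col ⟨u, hu⟩ = true <;> by_cases h3 : col ⟨w, hw⟩ = true <;>
        simp_all [patternM₁]

/-- Among pairs of non-neighbours of `v` in one component of `G - v` with different colours, take
one at minimum distance. A geodesic between them has odd length, and with `v` as hub it is an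
obstruction or a member of the family. -/
theorem isObstructed_of_not_admits (hF : IsInducedFree familyF₁ G) {v : V}
    (hv : (G.induce {v}ᶜ).IsBipartite) (hM : ¬ AdmitsMatrixPartition patternM₁ G) :
    G.IsObstructed v := by
  classical
  obtain ⟨C₀⟩ := hv
  let C : (G.induce {v}ᶜ).Coloring Bool :=
    (SimpleGraph.recolorOfEquiv _ finTwoEquiv) C₀
  have hex : ∃ n, ∃ u w : ({v}ᶜ : Set V), (G.induce {v}ᶜ).Reachable u w ∧ ¬ G.Adj v u ∧
      ¬ G.Adj v w ∧ C u ≠ C w ∧ (G.induce {v}ᶜ).dist u w = n := by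
    by_contra hne
    refine hM (admitsMatrixPartition_of_coloring C fun u w h1 h2 h3 => ?_)
    by_contra h4
    exact hne ⟨_, u, w, h1, h2, h3, h4, rfl⟩
  obtain ⟨u, w, hr, hu, hw, huw, hn⟩ := Nat.find_spec hex
  have hmin : ∀ u w : ({v}ᶜ : Set V), (G.induce {v}ᶜ).Reachable u w → ¬ G.Adj v u →
      ¬ G.Adj v w → C u ≠ C w → Nat.find hex ≤ (G.induce {v}ᶜ).dist u w :=
    fun u w h1 h2 h3 h4 => Nat.find_min' hex ⟨u, w, h1, h2, h3, h4, rfl⟩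
  rw [← hn] at hmin
  clear hn
  obtain ⟨p, hp⟩ := hr.exists_walk_length_eq_dist
  have hodd : Odd p.length := by
    rw [← Nat.not_even_iff_odd, C.even_length_iff_congr]
    simpa using huw
  have hadj : ∀ i j, i ≤ p.length → j ≤ p.length →
      (G.Adj (p.getVert i) (p.getVert j) ↔ i + 1 = j ∨ j + 1 = i) := fun i j hi hj =>
    p.adj_getVert_iff_of_length_eq_dist hp hi hj
  have hdist : ∀ i j, i ≤ j → j ≤ p.length →
      (G.induce {v}ᶜ).dist (p.getVert i) (p.getVert j) = j - i := fun i j =>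
    p.dist_getVert_of_length_eq_dist hp
  have h0 : p.getVert 0 = u := p.getVert_zero
  have hℓ : p.getVert p.length = w := p.getVert_length
  -- An inner non-neighbour of `v` would differ in colour from one of the two ends, giving a closer
  -- pair.
  have hint : ∀ i, 0 < i → i < p.length → G.Adj v (p.getVert i) := by
    intro i hi hi'
    by_contra hni
    by_cases hc : C u = C (p.getVert i)
    · have h1 := hmin (p.getVert i) w ((p.drop i).reachable) hni hw (fun h => huw (hc.trans h))
      have h2 := hdist _ _ hi'.le le_rfl
      rw [hℓ] at h2
      rw [h2, ← hp] at h1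
      omega
    · have h1 := hmin u (p.getVert i) ((p.take i).reachable) hu hni hc
      have h2 := hdist _ _ hi.le hi'.le
      rw [h0] at h2
      rw [h2, ← hp] at h1
      omega
  have hne : ∀ i, (p.getVert i : V) ≠ v := fun i => (p.getVert i).2
  have hnu : ¬ G.Adj v (p.getVert 0) := by rwa [h0]
  have hnw : ¬ G.Adj v (p.getVert p.length) := by rwa [hℓ]
  by_cases h5 : 5 ≤ p.length
  · exfalso
    refine hF _ ⟨p.length, hodd, h5, rfl⟩ ⟨⟨⟨fun o => o.elim v fun i => p.getVert i, ?_⟩, ?_⟩⟩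
    · intro a b hab
      rcases a with _ | i <;> rcases b with _ | j
      · rfl
      · exact absurd hab.symm (hne j)
      · exact absurd hab (hne i)
      · have hab' : p.getVert i = p.getVert j := Subtype.ext hab
        have hij := (p.isPath_of_length_eq_dist hp).getVert_injOn
          (show (i : ℕ) ≤ p.length by omega) (show (j : ℕ) ≤ p.length by omega) hab'
        exact congrArg some (Fin.ext hij)
    · have key : ∀ i : Fin (p.length + 1),
          G.Adj v (p.getVert i) ↔ 0 < i.val ∧ i.val < p.length := by
        intro i
        have := i.2
        refine ⟨fun h => ⟨?_, ?_⟩, fun h => hint i h.1 h.2⟩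
        · by_contra h'
          exact hnu (by rwa [show (i : ℕ) = 0 by omega] at h)
        · by_contra h'
          exact hnw (by rwa [show (i : ℕ) = p.length by omega] at h)
      intro a b
      rcases a with _ | i <;> rcases b with _ | j
      · simp
      · exact (key j).trans (pathWithHub_adj_none j).symm
      · rw [SimpleGraph.adj_comm, (pathWithHub _).adj_comm]
        exact (key i).trans (pathWithHub_adj_none i).symm
      · exact (hadj i j (by omega) (by omega)).trans (pathWithHub_adj_some i j).symm
  · have h13 : p.length = 1 ∨ p.length = 3 := by
      obtain ⟨k, hk⟩ := hodd
      omega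
    rcases h13 with h | h
    · refine .inl ⟨p.getVert 0, p.getVert 1, hne _, hne _, ?_, hnu, by rwa [h] at hnw⟩
      exact (hadj 0 1 (by omega) (by omega)).2 (by omega)
    · refine .inr ⟨p.getVert 0, p.getVert 1, p.getVert 2, p.getVert 3, hne _, hne _, ?_, ?_, ?_,
        hint 1 (by omega) (by omega), hint 2 (by omega) (by omega), hnu, by rwa [h] at hnw⟩
      · exact (hadj 0 1 (by omega) (by omega)).2 (by omega)
      · exact (hadj 1 2 (by omega) (by omega)).2 (by omega)
      · exact (hadj 2 3 (by omega) (by omega)).2 (by omega)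

/-! ### Recognising induced copies of the sporadic graphs -/

theorem SimpleGraph.isIndContained_of_forall_lt {n : ℕ} {H : SimpleGraph (Fin n)} (f : Fin n → V)
    (h : ∀ i j, i < j → f i ≠ f j ∧ (G.Adj (f i) (f j) ↔ H.Adj i j)) : H ⊴ G := by
  refine ⟨⟨⟨f, fun i j hij => ?_⟩, fun {i j} => ?_⟩⟩
  · rcases lt_trichotomy i j with h' | h' | h'
    · exact absurd hij (h i j h').1
    · exact h'
    · exact absurd hij.symm (h j i h').1
  · rcases lt_trichotomy i j with h' | rfl | h'
    · exact (h i j h').2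
    · simp
    · rw [SimpleGraph.adj_comm, H.adj_comm]
      exact (h j i h').2

theorem graphF₁_isIndContained {a b c d e : V} (hab : G.Adj a b) (hac : G.Adj a c)
    (hbc : G.Adj b c) (hde : G.Adj d e) (had : ¬ G.Adj a d) (hae : ¬ G.Adj a e)
    (hbd : ¬ G.Adj b d) (hbe : ¬ G.Adj b e) (hcd : ¬ G.Adj c d) (hce : ¬ G.Adj c e) :
    graphF₁ ⊴ G := by
  refine SimpleGraph.isIndContained_of_forall_lt ![a, b, c, d, e] fun i j hij => ?_
  have h1 : a ≠ b := hab.ne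
  have h2 : a ≠ c := hac.ne
  have h3 : b ≠ c := hbc.ne
  have h4 : d ≠ e := hde.ne
  have h5 : a ≠ d := fun h => hbd (h ▸ hab.symm)
  have h6 : a ≠ e := fun h => hbe (h ▸ hab.symm)
  have h7 : b ≠ d := fun h => had (h ▸ hab)
  have h8 : b ≠ e := fun h => hae (h ▸ hab)
  have h9 : c ≠ d := fun h => had (h ▸ hac)
  have h10 : c ≠ e := fun h => hae (h ▸ hac)
  fin_cases i <;> fin_cases j <;> first | (exfalso; revert hij; decide) | simp_all [graphF₁]

/-- Only adjacencies to the triangle need be given: an edge between two of the pendants would close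
a 4-cycle without chords. -/
theorem IsChordalGraph.graphF₂_isIndContained (hG : IsChordalGraph G) {a b c x y z : V}
    (hab : G.Adj a b) (hac : G.Adj a c) (hbc : G.Adj b c)
    (hax : G.Adj a x) (hby : G.Adj b y) (hcz : G.Adj c z)
    (hbx : ¬ G.Adj b x) (hcx : ¬ G.Adj c x) (hay : ¬ G.Adj a y) (hcy : ¬ G.Adj c y)
    (haz : ¬ G.Adj a z) (hbz : ¬ G.Adj b z) : graphF₂ ⊴ G := by
  have h1 : a ≠ b := hab.ne
  have h2 : a ≠ c := hac.ne
  have h3 : b ≠ c := hbc.ne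
  have h4 : a ≠ x := hax.ne
  have h5 : b ≠ y := hby.ne
  have h6 : c ≠ z := hcz.ne
  have h7 : b ≠ x := fun h => hcx (h ▸ hbc.symm)
  have h8 : c ≠ x := fun h => hbx (h ▸ hbc)
  have h9 : a ≠ y := fun h => hcy (h ▸ hac.symm)
  have h10 : c ≠ y := fun h => hay (h ▸ hac)
  have h11 : a ≠ z := fun h => hbz (h ▸ hab.symm)
  have h12 : b ≠ z := fun h => haz (h ▸ hab)
  have h13 : x ≠ y := fun h => hay (h ▸ hax)
  have h14 : x ≠ z := fun h => haz (h ▸ hax)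
  have h15 : y ≠ z := fun h => hbz (h ▸ hby)
  have h16 : ¬ G.Adj x y := fun h =>
    (hG.chord_of_cycle_four hax h hby.symm hab.symm h9 h7.symm).elim hay fun h' => hbx h'.symm
  have h17 : ¬ G.Adj x z := fun h =>
    (hG.chord_of_cycle_four hax h hcz.symm hac.symm h11 h8.symm).elim haz fun h' => hcx h'.symm
  have h18 : ¬ G.Adj y z := fun h =>
    (hG.chord_of_cycle_four hby h hcz.symm hbc.symm h12 h10.symm).elim hbz fun h' => hcy h'.symm
  refine SimpleGraph.isIndContained_of_forall_lt ![a, b, c, x, y, z] fun i j hij => ?_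
  fin_cases i <;> fin_cases j <;> first | (exfalso; revert hij; decide) | simp_all [graphF₂]

/-- Any edge or coincidence between the two pendant paths would contradict a given non-adjacency or
close a chordless cycle of length 4, 5 or 6. -/
theorem IsChordalGraph.graphF₃_isIndContained (hG : IsChordalGraph G) {a b c x y z w : V}
    (hab : G.Adj a b) (hac : G.Adj a c) (hbc : G.Adj b c)
    (hbx : G.Adj b x) (hxy : G.Adj x y) (hcz : G.Adj c z) (hzw : G.Adj z w)
    (hax : ¬ G.Adj a x) (hcx : ¬ G.Adj c x) (hay : ¬ G.Adj a y) (hby : ¬ G.Adj b y)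
    (hcy : ¬ G.Adj c y) (haz : ¬ G.Adj a z) (hbz : ¬ G.Adj b z) (haw : ¬ G.Adj a w)
    (hbw : ¬ G.Adj b w) (hcw : ¬ G.Adj c w) : graphF₃ ⊴ G := by
  have h1 : a ≠ b := hab.ne
  have h2 : a ≠ c := hac.ne
  have h3 : b ≠ c := hbc.ne
  have h4 : b ≠ x := hbx.ne
  have h5 : x ≠ y := hxy.ne
  have h6 : c ≠ z := hcz.ne
  have h7 : z ≠ w := hzw.ne
  have h8 : a ≠ x := fun h => hcx (h ▸ hac.symm)
  have h9 : c ≠ x := fun h => hax (h ▸ hac)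
  have h10 : a ≠ y := fun h => hby (h ▸ hab.symm)
  have h11 : b ≠ y := fun h => hay (h ▸ hab)
  have h12 : c ≠ y := fun h => hay (h ▸ hac)
  have h13 : a ≠ z := fun h => hbz (h ▸ hab.symm)
  have h14 : b ≠ z := fun h => haz (h ▸ hab)
  have h15 : a ≠ w := fun h => hbw (h ▸ hab.symm)
  have h16 : b ≠ w := fun h => haw (h ▸ hab)
  have h17 : c ≠ w := fun h => haw (h ▸ hac)
  have h18 : x ≠ z := fun h => hbz (h ▸ hbx)
  have h19 : x ≠ w := fun h => hbw (h ▸ hbx)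
  have h20 : y ≠ z := fun h => hcy (h ▸ hcz)
  have hxz : ¬ G.Adj x z := fun h =>
    (hG.chord_of_cycle_four hbx h hcz.symm hbc.symm h14 h9.symm).elim hbz fun h' => hcx h'.symm
  -- Such a `u` would complete the chordless 5-cycle `b x u z c`; applied to `y` and to `w`.
  have h5cycle : ∀ u, u ≠ b → u ≠ c → G.Adj x u → G.Adj u z → ¬ G.Adj b u → ¬ G.Adj c u →
      False := fun u hub huc hxu huz hbu hcu => by
    rcases hG.chord_of_cycle_five hbx hxu huz hcz.symm hbc.symm hub.symm h14 h18 h9.symm huc with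
      h | h | h | h | h
    exacts [hbu h, hbz h, hxz h, hcx h.symm, hcu h.symm]
  have h21 : y ≠ w := fun h => h5cycle y h11.symm h12.symm hxy (h ▸ hzw.symm) hby hcy
  have hyz : ¬ G.Adj y z := fun h => h5cycle y h11.symm h12.symm hxy h hby hcy
  have hxw : ¬ G.Adj x w := fun h => h5cycle w h16.symm h17.symm h hzw.symm hbw hcw
  have hyw : ¬ G.Adj y w := fun h => by
    rcases hG.chord_of_cycle_six hbx hxy h hzw.symm hcz.symm hbc.symm h11 h16 h14 h19 h18
      h9.symm h20 h12.symm h17.symm with h | h | h | h | h | h | h | h | h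
    exacts [hby h, hbw h, hbz h, hxw h, hxz h, hcx h.symm, hyz h, hcy h.symm, hcw h.symm]
  clear hG h5cycle
  refine SimpleGraph.isIndContained_of_forall_lt ![a, b, c, x, y, z, w] fun i j hij => ?_
  fin_cases i <;> fin_cases j <;> first | (exfalso; revert hij; decide) | simp_all [graphF₃]

/-- If all triangles contain `v`, then a path `x, a, b, y` and vertices `c`, `d` as in `F₄` induce a
copy of `F₄`. -/
theorem IsChordalGraph.graphF₄_isIndContained (hG : IsChordalGraph G) {v a b c d x y : V}
    (hT : ∀ x y z, G.Adj x y → G.Adj y z → G.Adj z x → v = x ∨ v = y ∨ v = z)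
    (hva : G.Adj v a) (hvb : G.Adj v b) (hvc : G.Adj v c) (hvd : G.Adj v d) (hab : G.Adj a b)
    (hca : G.Adj c a) (hbd : G.Adj b d) (hax : G.Adj a x) (hby : G.Adj b y)
    (hvx : ¬ G.Adj v x) (hvy : ¬ G.Adj v y) (hxv : x ≠ v) (hyv : y ≠ v) (hcb : c ≠ b)
    (hda : d ≠ a) : graphF₄ ⊴ G := by
  have hT' : ∀ x y z, v ≠ x → v ≠ y → v ≠ z → G.Adj x y → G.Adj y z → G.Adj x z → False :=
    fun x y z h1 h2 h3 hxy hyz hxz => by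
      rcases hT x y z hxy hyz hxz.symm with h | h | h
      exacts [h1 h, h2 h, h3 h]
  -- A chord of a 4-cycle avoiding `v` would give a triangle avoiding `v`.
  have hC4 : ∀ x y z w, v ≠ x → v ≠ y → v ≠ z → v ≠ w → x ≠ z → y ≠ w → G.Adj x y → G.Adj y z →
      G.Adj z w → ¬ G.Adj w x := fun x y z w h1 h2 h3 h4 h5 h6 hxy hyz hzw hwx => by
    rcases hG.chord_of_cycle_four hxy hyz hzw hwx h5 h6 with h | h
    · exact hT' x y z h1 h2 h3 hxy hyz h
    · exact hT' y z w h2 h3 h4 hyz hzw h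
  have e1 := hva.ne
  have e2 := hvb.ne
  have e3 := hvc.ne
  have e4 := hvd.ne
  have e5 := hab.ne
  have e6 := hca.ne
  have e7 := hbd.ne
  have e8 := hax.ne
  have e9 := hby.ne
  have e10 : x ≠ b := fun h => hvx (h ▸ hvb)
  have e11 : x ≠ c := fun h => hvx (h ▸ hvc)
  have e12 : x ≠ d := fun h => hvx (h ▸ hvd)
  have e13 : y ≠ a := fun h => hvy (h ▸ hva)
  have e14 : y ≠ c := fun h => hvy (h ▸ hvc)
  have e15 : y ≠ d := fun h => hvy (h ▸ hvd)
  have e16 : c ≠ d := fun h => hT' c a b e3 e1 e2 hca hab (h ▸ hbd.symm)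
  have e17 : x ≠ y := fun h => hT' x a b hxv.symm e1 e2 hax.symm hab (h ▸ hby.symm)
  have n1 : ¬ G.Adj c b := hT' c a b e3 e1 e2 hca hab
  have n2 : ¬ G.Adj a d := hT' a b d e1 e2 e4 hab hbd
  have n3 : ¬ G.Adj c d := fun h => hC4 c a b d e3 e1 e2 e4 hcb hda.symm hca hab hbd h.symm
  have n4 : ¬ G.Adj b x := fun h => hT' x a b hxv.symm e1 e2 hax.symm hab h.symm
  have n5 : ¬ G.Adj c x := hT' c a x e3 e1 hxv.symm hca hax
  have n6 : ¬ G.Adj d x := hC4 x a b d hxv.symm e1 e2 e4 e10 hda.symm hax.symm hab hbd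
  have n7 : ¬ G.Adj a y := hT' a b y e1 e2 hyv.symm hab hby
  have n8 : ¬ G.Adj d y := hT' d b y e4 e2 hyv.symm hbd.symm hby
  have n9 : ¬ G.Adj c y := hC4 y b a c hyv.symm e2 e1 e3 e13 hcb.symm hby.symm hab.symm hca.symm
  have n10 : ¬ G.Adj x y := fun h =>
    hC4 x a b y hxv.symm e1 e2 hyv.symm e10 e13.symm hax.symm hab hby h.symm
  refine SimpleGraph.isIndContained_of_forall_lt ![v, a, b, x, y, d, c] fun i j hij => ?_
  rw [G.adj_comm] at hca n1 n3 n5 n6 n8 n9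
  rw [ne_comm] at hcb e6 e10 hda e13 e16 hxv hyv
  clear hT hT' hC4 hG
  fin_cases i <;> fin_cases j <;> first | (exfalso; revert hij; decide) | simp_all [graphF₄]

/-! ### Vertices meeting all triangles, and what is attached to a triangle -/

/-- Every triangle of `G` contains the vertex `v`. -/
def SimpleGraph.CoversTriangles (G : SimpleGraph V) (v : V) : Prop :=
  ∀ x y z, G.Adj x y → G.Adj y z → G.Adj z x → v = x ∨ v = y ∨ v = z

/-- The vertex `s` of the triangle `s, t, r` has a private neighbour. -/
def SimpleGraph.HasPendant (G : SimpleGraph V) (s t r : V) : Prop :=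
  ∃ x, G.Adj s x ∧ ¬ G.Adj t x ∧ ¬ G.Adj r x

/-- The vertex `s` of the triangle `s, t, r` is the end of an induced path with two further vertices
none of which is adjacent to `t` or `r`. -/
def SimpleGraph.HasPendantPath (G : SimpleGraph V) (s t r : V) : Prop :=
  ∃ x y, G.Adj s x ∧ G.Adj x y ∧ ¬ G.Adj t x ∧ ¬ G.Adj r x ∧ ¬ G.Adj s y ∧ ¬ G.Adj t y ∧
    ¬ G.Adj r y

theorem SimpleGraph.HasPendant.swap {s t r : V} (h : G.HasPendant s t r) : G.HasPendant s r t :=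
  let ⟨x, h1, h2, h3⟩ := h
  ⟨x, h1, h3, h2⟩

theorem SimpleGraph.HasPendantPath.swap {s t r : V} (h : G.HasPendantPath s t r) :
    G.HasPendantPath s r t :=
  let ⟨x, y, h1, h2, h3, h4, h5, h6, h7⟩ := h
  ⟨x, y, h1, h2, h4, h3, h5, h7, h6⟩

theorem SimpleGraph.HasPendantPath.hasPendant {s t r : V} (h : G.HasPendantPath s t r) :
    G.HasPendant s t r :=
  let ⟨x, _, h1, _, h3, h4, _⟩ := h
  ⟨x, h1, h3, h4⟩

theorem SimpleGraph.CoversTriangles.not_adj {v x y z : V} (hT : G.CoversTriangles v) (hx : v ≠ x)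
    (hy : v ≠ y) (hz : v ≠ z) (hxy : G.Adj x y) (hyz : G.Adj y z) : ¬ G.Adj x z := fun hxz => by
  rcases hT x y z hxy hyz hxz.symm with h | h | h
  exacts [hx h, hy h, hz h]

theorem SimpleGraph.CoversTriangles.exists_of_not {v a : V} (hT : G.CoversTriangles v)
    (ha : ¬ G.CoversTriangles a) :
    ∃ r s, G.Adj v r ∧ G.Adj v s ∧ G.Adj r s ∧ r ≠ a ∧ s ≠ a := by
  simp only [SimpleGraph.CoversTriangles, not_forall, not_or] at ha
  obtain ⟨x, y, z, hxy, hyz, hzx, hx, hy, hz⟩ := ha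
  rcases hT x y z hxy hyz hzx with rfl | rfl | rfl
  · exact ⟨y, z, hxy, hzx.symm, hyz, Ne.symm hy, Ne.symm hz⟩
  · exact ⟨x, z, hxy.symm, hyz, hzx.symm, Ne.symm hx, Ne.symm hz⟩
  · exact ⟨x, y, hzx, hyz.symm, hxy, Ne.symm hx, Ne.symm hy⟩

namespace IsChordalGraph

theorem not_adj_of_path_four (hG : IsChordalGraph G) {v x y z w : V} (hT : G.CoversTriangles v)
    (hx : v ≠ x) (hy : v ≠ y) (hz : v ≠ z) (hw : v ≠ w) (hxz : x ≠ z) (hyw : y ≠ w)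
    (hxy : G.Adj x y) (hyz : G.Adj y z) (hzw : G.Adj z w) : ¬ G.Adj x w := fun hxw => by
  rcases hG.chord_of_cycle_four hxy hyz hzw hxw.symm hxz hyw with h | h
  · exact hT.not_adj hx hy hz hxy hyz h
  · exact hT.not_adj hy hz hw hyz hzw h

/-- Two distinct neighbours of `v` are not both joined to an edge outside the closed neighbourhood
of `v`. -/
theorem eq_of_adj_edge (hG : IsChordalGraph G) {v p q s t : V} (hT : G.CoversTriangles v)
    (hvp : G.Adj v p) (hvq : G.Adj v q) (hs : s ≠ v) (ht : t ≠ v) (hst : G.Adj s t)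
    (hvs : ¬ G.Adj v s) (hvt : ¬ G.Adj v t) (hp : G.Adj p s ∨ G.Adj p t)
    (hq : G.Adj q s ∨ G.Adj q t) : p = q := by
  by_contra hpq
  have common : ∀ s, s ≠ v → ¬ G.Adj v s → G.Adj p s → ¬ G.Adj q s := fun s hs hvs hps hqs => by
    rcases hG.chord_of_cycle_four hvp hps hqs.symm hvq.symm hs.symm hpq with h | h
    · exact hvs h
    · exact hT.not_adj hvp.ne hs.symm hvq.ne hps hqs.symm h
  -- Every chord of the 5-cycle `v p s t q` is excluded: it contradicts `hvs` or `hvt`, or yields a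
  -- triangle or a 4-cycle avoiding `v`.
  have cross : ∀ s t, s ≠ v → t ≠ v → G.Adj s t → ¬ G.Adj v s → ¬ G.Adj v t → G.Adj p s →
      ¬ G.Adj q t := fun s t hs ht hst hvs hvt hps hqt => by
    have hpt : p ≠ t := fun h => hvt (h ▸ hvp)
    have hsq : s ≠ q := fun h => hvs (h ▸ hvq)
    rcases hG.chord_of_cycle_five hvp hps hst hqt.symm hvq.symm hs.symm ht.symm hpt hpq hsq with
      h | h | h | h | h
    · exact hvs h
    · exact hvt h
    · exact hT.not_adj hvp.ne hs.symm ht.symm hps hst h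
    · exact hG.not_adj_of_path_four hT hvp.ne hs.symm ht.symm hvq.ne hpt hsq hps hst hqt.symm h
    · exact hT.not_adj hs.symm ht.symm hvq.ne hst hqt.symm h
  rcases hp with hp | hp <;> rcases hq with hq | hq
  · exact common s hs hvs hp hq
  · exact cross s t hs ht hst hvs hvt hp hq
  · exact cross t s ht hs hst.symm hvt hvs hp hq
  · exact common t ht hvt hp hq

/-- By `eq_of_adj_edge`, `a` is the only neighbour of `v` joined to the edge `x y`, so `b` sees
neither end; and `a` sees only one end, as otherwise `a x y` would be a triangle avoiding `v`. -/
theorem hasPendantPath (hG : IsChordalGraph G) {v a b x y : V} (hT : G.CoversTriangles v)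
    (hva : G.Adj v a) (hvb : G.Adj v b) (hab : G.Adj a b) (hx : x ≠ v) (hy : y ≠ v)
    (hxy : G.Adj x y) (hvx : ¬ G.Adj v x) (hvy : ¬ G.Adj v y) (ha : G.Adj a x ∨ G.Adj a y) :
    G.HasPendantPath a v b := by
  have key : ∀ x y, x ≠ v → y ≠ v → G.Adj x y → ¬ G.Adj v x → ¬ G.Adj v y → G.Adj a x →
      G.HasPendantPath a v b := fun x y hx hy hxy hvx hvy hax =>
    ⟨x, y, hax, hxy, hvx, fun h => hab.ne (hG.eq_of_adj_edge hT hva hvb hx hy hxy hvx hvy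
        (.inl hax) (.inl h)),
      hT.not_adj hva.ne hx.symm hy.symm hax hxy, hvy,
      fun h => hab.ne (hG.eq_of_adj_edge hT hva hvb hx hy hxy hvx hvy (.inl hax) (.inr h))⟩
  exact ha.elim (key x y hx hy hxy hvx hvy) (key y x hy hx hxy.symm hvy hvx)

theorem graphF₂_of_hasPendant (hG : IsChordalGraph G) {a b c : V} (hab : G.Adj a b)
    (hac : G.Adj a c) (hbc : G.Adj b c) (ha : G.HasPendant a b c) (hb : G.HasPendant b a c)
    (hc : G.HasPendant c a b) : graphF₂ ⊴ G := by
  obtain ⟨x, h1, h2, h3⟩ := ha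
  obtain ⟨y, h4, h5, h6⟩ := hb
  obtain ⟨z, h7, h8, h9⟩ := hc
  exact hG.graphF₂_isIndContained hab hac hbc h1 h4 h7 h2 h3 h5 h6 h8 h9

theorem graphF₃_of_hasPendantPath (hG : IsChordalGraph G) {a b c : V} (hab : G.Adj a b)
    (hac : G.Adj a c) (hbc : G.Adj b c) (ha : G.HasPendantPath a b c)
    (hb : G.HasPendantPath b a c) : graphF₃ ⊴ G := by
  obtain ⟨x, y, h1, h2, h3, h4, h5, h6, h7⟩ := ha
  obtain ⟨z, w, k1, k2, k3, k4, k5, k6, k7⟩ := hb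
  exact hG.graphF₃_isIndContained hac.symm hbc.symm hab h1 h2 k1 k2 h4 h3 h7 h5 h6 k4 k3 k7 k6 k5

end IsChordalGraph

theorem SimpleGraph.CoversTriangles.hasPendant {v a b x : V} (hT : G.CoversTriangles v)
    (hva : G.Adj v a) (hvb : G.Adj v b) (hab : G.Adj a b) (hx : x ≠ v) (hvx : ¬ G.Adj v x)
    (hax : G.Adj a x) : G.HasPendant a v b :=
  ⟨x, hax, hvx, hT.not_adj hvb.ne hva.ne hx.symm hab.symm hax⟩

/-- An edge outside the closed neighbourhood of a vertex of a triangle is joined to the triangle in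
an `F₁`-free graph. -/
theorem adj_of_not_graphF₁ (hF₁ : ¬ graphF₁ ⊴ G) {v a b x y : V} (hva : G.Adj v a)
    (hvb : G.Adj v b) (hab : G.Adj a b) (hxy : G.Adj x y) (hvx : ¬ G.Adj v x)
    (hvy : ¬ G.Adj v y) : (G.Adj a x ∨ G.Adj a y) ∨ G.Adj b x ∨ G.Adj b y := by
  by_contra h
  push Not at h
  exact hF₁ (graphF₁_isIndContained hva hvb hab hxy hvx hvy h.1.1 h.1.2 h.2.1 h.2.2)

namespace IsChordalGraph

/-- In an obstructed configuration of the second kind, the edge `p q` meets every triangle. -/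
theorem eq_or_eq_of_triangle (hG : IsChordalGraph G) (hF₂ : ¬ graphF₂ ⊴ G) {v x p q y r s : V}
    (hT : G.CoversTriangles v) (hx : x ≠ v) (hy : y ≠ v) (hxp : G.Adj x p) (hpq : G.Adj p q)
    (hqy : G.Adj q y) (hvp : G.Adj v p) (hvq : G.Adj v q) (hvx : ¬ G.Adj v x) (hvy : ¬ G.Adj v y)
    (hvr : G.Adj v r) (hvs : G.Adj v s) (hrs : G.Adj r s) : p = r ∨ p = s ∨ q = r ∨ q = s := by
  by_contra hne
  push Not at hne
  obtain ⟨hpr, hps, hqr, hqs⟩ := hne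
  have hp := hT.hasPendant hvp hvq hpq hx hvx hxp.symm
  have hq := hT.hasPendant hvq hvp hpq.symm hy hvy hqy
  -- `p` and `q` have private neighbours `x` and `y`, so a private neighbour of `v` would complete a
  -- net.
  have key : ∀ z, G.Adj v z → ¬ (¬ G.Adj p z ∧ ¬ G.Adj q z) := fun z hvz hz =>
    hF₂ (hG.graphF₂_of_hasPendant hvp hvq hpq ⟨z, hvz, hz⟩ hp hq)
  -- If `p` is adjacent to `r`, then `s` sees neither `p` (triangle `p r s`) nor `q` (4-cycle `q p r
  -- s`), which makes `s` private to `v`.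
  have side : ∀ p q, p ≠ s → q ≠ r → G.Adj v p → G.Adj v q → G.Adj p q → G.Adj p r →
      ¬ G.Adj p s ∧ ¬ G.Adj q s := fun p q hps hqr hvp hvq hpq hpr =>
    ⟨hT.not_adj hvp.ne hvr.ne hvs.ne hpr hrs,
      hG.not_adj_of_path_four hT hvq.ne hvp.ne hvr.ne hvs.ne hqr hps hpq.symm hpr hrs⟩
  refine key r hvr ⟨fun h => key s hvs (side p q hps hqr hvp hvq hpq h), fun h => ?_⟩
  exact key s hvs (side q p hqs hpr hvq hvp hpq.symm h).symm

/-- An obstructed vertex of a triangle meeting all triangles is not the only such vertex. -/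
theorem exists_adj_coversTriangles (hG : IsChordalGraph G) (hF₁ : ¬ graphF₁ ⊴ G)
    (hF₂ : ¬ graphF₂ ⊴ G) (hF₄ : ¬ graphF₄ ⊴ G) {v a b : V} (hT : G.CoversTriangles v)
    (hva : G.Adj v a) (hvb : G.Adj v b) (hab : G.Adj a b) (hv : G.IsObstructed v) :
    ∃ u, G.Adj v u ∧ G.CoversTriangles u := by
  by_contra hne
  push Not at hne
  rcases hv with ⟨x, y, hx, hy, hxy, hvx, hvy⟩ |
    ⟨x, p, q, y, hx, hy, hxp, hpq, hqy, hvp, hvq, hvx, hvy⟩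
  -- Every triangle at `v` must be joined to `x y` by `F₁`-freeness, and only `c` can do it; so `c`
  -- would lie in every triangle.
  · obtain ⟨c, hvc, hc⟩ : ∃ c, G.Adj v c ∧ (G.Adj c x ∨ G.Adj c y) :=
      (adj_of_not_graphF₁ hF₁ hva hvb hab hxy hvx hvy).elim (fun h => ⟨a, hva, h⟩)
        fun h => ⟨b, hvb, h⟩
    obtain ⟨r, s, hvr, hvs, hrs, hrc, hsc⟩ := hT.exists_of_not (hne c hvc)
    rcases adj_of_not_graphF₁ hF₁ hvr hvs hrs hxy hvx hvy with h | h
    · exact hrc (hG.eq_of_adj_edge hT hvr hvc hx hy hxy hvx hvy h hc)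
    · exact hsc (hG.eq_of_adj_edge hT hvs hvc hx hy hxy hvx hvy h hc)
  -- A triangle avoiding `p` must use `q`, since the edge `p q` meets every triangle; `d` is its
  -- third vertex. Both orientations of the path together give `F₄`.
  · have key : ∀ x p q y, x ≠ v → y ≠ v → G.Adj x p → G.Adj p q → G.Adj q y → G.Adj v p →
        G.Adj v q → ¬ G.Adj v x → ¬ G.Adj v y → ∃ d, G.Adj v d ∧ d ≠ p ∧ G.Adj q d := by
      intro x p q y hx hy hxp hpq hqy hvp hvq hvx hvy
      obtain ⟨r, s, hvr, hvs, hrs, hrp, hsp⟩ := hT.exists_of_not (hne p hvp)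
      rcases hG.eq_or_eq_of_triangle hF₂ hT hx hy hxp hpq hqy hvp hvq hvx hvy hvr hvs hrs with
        rfl | rfl | rfl | rfl
      · exact absurd rfl hrp
      · exact absurd rfl hsp
      · exact ⟨s, hvs, hsp, hrs⟩
      · exact ⟨r, hvr, hrp, hrs.symm⟩
    obtain ⟨d, hvd, hdp, hqd⟩ := key x p q y hx hy hxp hpq hqy hvp hvq hvx hvy
    obtain ⟨c, hvc, hcq, hpc⟩ :=
      key y q p x hy hx hqy.symm hpq.symm hxp.symm hvq hvp hvy hvx
    exact hF₄ (hG.graphF₄_isIndContained hT hvp hvq hvc hvd hpq hpc.symm hqd hxp.symm hqy hvx hvy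
      hx hy hcq hdp)

/-- The obstructions at a vertex of a triangle meeting all triangles. -/
theorem hasPendant_of_isObstructed (hG : IsChordalGraph G) (hF₁ : ¬ graphF₁ ⊴ G) {v a b : V}
    (hTv : G.CoversTriangles v) (hTa : G.CoversTriangles a) (hTb : G.CoversTriangles b)
    (hva : G.Adj v a) (hvb : G.Adj v b) (hab : G.Adj a b) (hv : G.IsObstructed v) :
    G.HasPendantPath a v b ∨ G.HasPendantPath b v a ∨
      (G.HasPendant a v b ∧ G.HasPendant b v a) := by
  rcases hv with ⟨x, y, hx, hy, hxy, hvx, hvy⟩ |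
    ⟨x, p, q, y, hx, hy, hxp, hpq, hqy, hvp, hvq, hvx, hvy⟩
  · rcases adj_of_not_graphF₁ hF₁ hva hvb hab hxy hvx hvy with h | h
    · exact .inl (hG.hasPendantPath hTv hva hvb hab hx hy hxy hvx hvy h)
    · exact .inr (.inl (hG.hasPendantPath hTv hvb hva hab.symm hx hy hxy hvx hvy h))
  · have hp := hTv.hasPendant hvp hvq hpq hx hvx hxp.symm
    have hq := hTv.hasPendant hvq hvp hpq.symm hy hvy hqy
    -- The triangle `v p q` contains both `a` and `b`, so `{p, q} = {a, b}`.
    rcases hTa v p q hvp hpq hvq.symm with rfl | rfl | rfl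
    · exact absurd rfl hva.ne
    · rcases hTb v a q hvp hpq hvq.symm with rfl | rfl | rfl
      exacts [absurd rfl hvb.ne, absurd rfl hab.ne, .inr (.inr ⟨hp, hq⟩)]
    · rcases hTb v p a hvp hpq hvq.symm with rfl | rfl | rfl
      exacts [absurd rfl hvb.ne, .inr (.inr ⟨hq, hp⟩), absurd rfl hab.ne]

/-- The obstructions at a vertex of an edge contained in at least two triangles and meeting all
triangles in both ends. -/
theorem hasPendant_of_isObstructed_of_ne (hG : IsChordalGraph G) (hF₁ : ¬ graphF₁ ⊴ G)
    {v a b c : V} (hTv : G.CoversTriangles v) (hTa : G.CoversTriangles a) (hva : G.Adj v a)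
    (hvb : G.Adj v b) (hab : G.Adj a b) (hvc : G.Adj v c) (hac : G.Adj a c) (hbc : b ≠ c)
    (hv : G.IsObstructed v) :
    (∀ l, G.Adj v l → G.Adj a l → G.HasPendantPath a v l) ∨
      ∃ l, G.Adj v l ∧ G.Adj a l ∧ G.HasPendant a v l ∧ G.HasPendant l v a := by
  rcases hv with ⟨x, y, hx, hy, hxy, hvx, hvy⟩ |
    ⟨x, p, q, y, hx, hy, hxp, hpq, hqy, hvp, hvq, hvx, hvy⟩
  -- If `a` were not joined to `x y`, then both `b` and `c` would be, against uniqueness of the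
  -- joined neighbour.
  · have ha : G.Adj a x ∨ G.Adj a y := by
      rcases adj_of_not_graphF₁ hF₁ hva hvb hab hxy hvx hvy with h | h
      · exact h
      · rcases adj_of_not_graphF₁ hF₁ hva hvc hac hxy hvx hvy with h' | h'
        · exact h'
        · exact absurd (hG.eq_of_adj_edge hTv hvb hvc hx hy hxy hvx hvy h h') hbc
    exact .inl fun l hvl hal => hG.hasPendantPath hTv hva hvl hal hx hy hxy hvx hvy ha
  · have hp := hTv.hasPendant hvp hvq hpq hx hvx hxp.symm
    have hq := hTv.hasPendant hvq hvp hpq.symm hy hvy hqy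
    rcases hTa v p q hvp hpq hvq.symm with rfl | rfl | rfl
    · exact absurd rfl hva.ne
    · exact .inr ⟨q, hvq, hpq, hp, hq⟩
    · exact .inr ⟨p, hvp, hpq.symm, hq, hp⟩

/-- The triangle `v u l` has two vertices meeting all triangles. If `l` does too, the obstructions
at all three are played off against each other; otherwise `v u` lies in a second triangle, and the
obstructions at `v` and `u` suffice. -/
theorem not_forall_isObstructed (hG : IsChordalGraph G) (hF₁ : ¬ graphF₁ ⊴ G)
    (hF₂ : ¬ graphF₂ ⊴ G) (hF₃ : ¬ graphF₃ ⊴ G) (hF₄ : ¬ graphF₄ ⊴ G) {v a b : V}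
    (hT : G.CoversTriangles v) (hva : G.Adj v a) (hvb : G.Adj v b) (hab : G.Adj a b) :
    ¬ ∀ u, G.CoversTriangles u → G.IsObstructed u := by
  intro hobs
  obtain ⟨u, hvu, hTu⟩ := hG.exists_adj_coversTriangles hF₁ hF₂ hF₄ hT hva hvb hab (hobs v hT)
  obtain ⟨l, hvl, hul⟩ : ∃ l, G.Adj v l ∧ G.Adj u l := by
    rcases hTu v a b hva hab hvb.symm with rfl | rfl | rfl
    exacts [absurd rfl hvu.ne, ⟨b, hvb, hab⟩, ⟨a, hva, hab.symm⟩]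
  by_cases hTl : G.CoversTriangles l
  · have h1 := hG.hasPendant_of_isObstructed hF₁ hT hTu hTl hvu hvl hul (hobs v hT)
    have h2 := hG.hasPendant_of_isObstructed hF₁ hTu hT hTl hvu.symm hul hvl (hobs u hTu)
    have h3 := hG.hasPendant_of_isObstructed hF₁ hTl hT hTu hvl.symm hul.symm hvu (hobs l hTl)
    have n := fun h h' h'' => hF₂ (hG.graphF₂_of_hasPendant hvu hvl hul h h' h'')
    have k1 := fun h h' => hF₃ (hG.graphF₃_of_hasPendantPath hvu hvl hul h h')
    have k2 := fun h h' => hF₃ (hG.graphF₃_of_hasPendantPath hvl hvu hul.symm h h')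
    have k3 := fun h h' => hF₃ (hG.graphF₃_of_hasPendantPath hul hvu.symm hvl.symm h h')
    have s : ∀ a b c, G.HasPendantPath a b c → G.HasPendantPath a c b := fun _ _ _ h => h.swap
    have t : ∀ a b c, G.HasPendant a b c → G.HasPendant a c b := fun _ _ _ h => h.swap
    have w : ∀ a b c, G.HasPendantPath a b c → G.HasPendant a b c := fun _ _ _ h => h.hasPendant
    -- Two pendant paths give `F₃`, so at most one vertex has one. If one does, the obstruction at
    -- that vertex must give private neighbours to the other two; if none does, all three have
    -- private neighbours anyway. Either way a net arises.
    grind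
  · obtain ⟨c, hvc, huc, hcl⟩ : ∃ c, G.Adj v c ∧ G.Adj u c ∧ l ≠ c := by
      obtain ⟨r, s, hvr, hvs, hrs, hrl, hsl⟩ := hT.exists_of_not hTl
      rcases hTu v r s hvr hrs hvs.symm with rfl | rfl | rfl
      exacts [absurd rfl hvu.ne, ⟨s, hvs, hrs, hsl.symm⟩, ⟨r, hvr, hrs.symm, hrl.symm⟩]
    have h1 := hG.hasPendant_of_isObstructed_of_ne hF₁ hT hTu hvu hvl hul hvc huc hcl (hobs v hT)
    have h2 := hG.hasPendant_of_isObstructed_of_ne hF₁ hTu hT hvu.symm hul hvl huc hvc hcl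
      (hobs u hTu)
    rcases h1 with h1 | ⟨m, hvm, hum, h1, h1'⟩
    · rcases h2 with h2 | ⟨m, hum, hvm, h2, h2'⟩
      · exact hF₃ (hG.graphF₃_of_hasPendantPath hvu hvl hul (h2 l hul hvl) (h1 l hvl hul))
      · exact hF₂ (hG.graphF₂_of_hasPendant hvu hvm hum h2 (h1 m hvm hum).hasPendant h2'.swap)
    -- The private neighbour of `v` may come from another triangle `v u n`, but it is still not
    -- adjacent to `m`, since every triangle contains `u`.
    · have hv : G.HasPendant v u m := by
        rcases h2 with h2 | ⟨n, hun, hvn, ⟨z, hvz, huz, hnz⟩, -⟩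
        · exact (h2 m hum hvm).hasPendant
        · exact hTu.hasPendant hvu.symm hum hvm (by rintro rfl; exact hnz hun.symm) huz hvz
      exact hF₂ (hG.graphF₂_of_hasPendant hvu hvm hum hv h1 h1')

end IsChordalGraph

end

/-! ### The forbidden graphs have no `M₁`-partition -/

theorem AdmitsMatrixPartition.of_isIndContained {V W : Type*} {m : ℕ}
    {M : Matrix (Fin m) (Fin m) PatternEntry} {G : SimpleGraph V} {H : SimpleGraph W}
    (hG : AdmitsMatrixPartition M G) (hH : H ⊴ G) : AdmitsMatrixPartition M H := by
  obtain ⟨part, hpart⟩ := hG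
  obtain ⟨f⟩ := hH
  refine ⟨part ∘ f, fun u v huv => ?_⟩
  simpa using hpart (f u) (f v) (f.injective.ne huv)

theorem isMatrixPartition_patternM₁_iff {V : Type*} {G : SimpleGraph V} {part : V → Fin 3} :
    IsMatrixPartition patternM₁ G part ↔ (∀ u v, G.Adj u v → part u ≠ part v) ∧
      ∀ u v, ¬ G.Adj u v → part u = 1 → part v ≠ 2 := by
  constructor
  · refine fun h => ⟨fun u v huv he => (h u v huv.ne).2 ?_ huv, fun u v huv hu hv => huv ?_⟩
    · rw [he]
      generalize part v = i
      fin_cases i <;> rfl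
    · refine (h u v ?_).1 ?_
      · rintro rfl
        simp [hu] at hv
      · rw [hu, hv]
        rfl
  · rintro ⟨h1, h2⟩ u v -
    have h3 := h1 u v
    have h4 := h2 u v
    have h5 := h2 v u
    rw [G.adj_comm v u] at h5
    generalize part u = i at *
    generalize part v = j at *
    fin_cases i <;> fin_cases j <;> simp_all [patternM₁]

namespace IsMatrixPartition

variable {V : Type*} {G : SimpleGraph V} {part : V → Fin 3}

theorem ne_of_adj (hp : IsMatrixPartition patternM₁ G part) {u v : V} (huv : G.Adj u v) :
    part u ≠ part v :=
  (isMatrixPartition_patternM₁_iff.1 hp).1 u v huv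

theorem of_not_adj (hp : IsMatrixPartition patternM₁ G part) {u v : V} (huv : ¬ G.Adj u v) :
    (part u = 1 → part v ≠ 2) ∧ (part u = 2 → part v ≠ 1) :=
  ⟨(isMatrixPartition_patternM₁_iff.1 hp).2 u v huv, fun h h' =>
    (isMatrixPartition_patternM₁_iff.1 hp).2 v u (fun h => huv h.symm) h' h⟩

/-- A triangle meets all three parts, so a vertex of `V₂` or `V₃` is adjacent to one of its
vertices. -/
theorem eq_zero_of_not_adj (hp : IsMatrixPartition patternM₁ G part) {a b c x : V}
    (hab : G.Adj a b) (hac : G.Adj a c) (hbc : G.Adj b c) (hax : ¬ G.Adj a x)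
    (hbx : ¬ G.Adj b x) (hcx : ¬ G.Adj c x) : part x = 0 := by
  have key : ∀ a b : Fin 3, a ≠ b → ∀ c, a ≠ c → b ≠ c → ∀ d : Fin 3,
      ((a = 1 → d ≠ 2) ∧ (a = 2 → d ≠ 1)) → ((b = 1 → d ≠ 2) ∧ (b = 2 → d ≠ 1)) →
      ((c = 1 → d ≠ 2) ∧ (c = 2 → d ≠ 1)) → d = 0 := by
    intros
    omega
  exact key _ _ (hp.ne_of_adj hab) _ (hp.ne_of_adj hac) (hp.ne_of_adj hbc) _ (hp.of_not_adj hax)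
    (hp.of_not_adj hbx) (hp.of_not_adj hcx)

/-- If `a` were in `V₁`, then `b` and `c` would occupy `V₂` and `V₃`, and the private neighbour of
`a`, not being in `V₁`, would be adjacent to one of them. -/
theorem ne_zero_of_hasPendant (hp : IsMatrixPartition patternM₁ G part) {a b c : V}
    (hab : G.Adj a b) (hac : G.Adj a c) (hbc : G.Adj b c) (ha : G.HasPendant a b c) :
    part a ≠ 0 := by
  obtain ⟨x, hax, hbx, hcx⟩ := ha
  have key : ∀ a b : Fin 3, a ≠ b → ∀ c, a ≠ c → b ≠ c → ∀ d, a ≠ d →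
      ((b = 1 → d ≠ 2) ∧ (b = 2 → d ≠ 1)) → ((c = 1 → d ≠ 2) ∧ (c = 2 → d ≠ 1)) → a ≠ 0 := by
    decide
  exact key _ _ (hp.ne_of_adj hab) _ (hp.ne_of_adj hac) (hp.ne_of_adj hbc) _ (hp.ne_of_adj hax)
    (hp.of_not_adj hbx) (hp.of_not_adj hcx)

end IsMatrixPartition

theorem not_admitsMatrixPartition_graphF₁ : ¬ AdmitsMatrixPartition patternM₁ graphF₁ := by
  rintro ⟨p, hp⟩
  have h : ∀ d : Fin 5, 3 ≤ d → p d = 0 := by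
    intro d hd
    refine hp.eq_zero_of_not_adj (a := 0) (b := 1) (c := 2) ?_ ?_ ?_ ?_ ?_ ?_ <;>
      revert d <;> simp [graphF₁] <;> decide
  exact hp.ne_of_adj (u := 3) (v := 4) (by simp [graphF₁])
    ((h 3 (by decide)).trans (h 4 (by decide)).symm)

theorem not_admitsMatrixPartition_graphF₂ : ¬ AdmitsMatrixPartition patternM₁ graphF₂ := by
  rintro ⟨p, hp⟩
  have h01 : graphF₂.Adj 0 1 := by simp [graphF₂]
  have h02 : graphF₂.Adj 0 2 := by simp [graphF₂]
  have h12 : graphF₂.Adj 1 2 := by simp [graphF₂]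
  have h0 := hp.ne_zero_of_hasPendant h01 h02 h12 ⟨3, by simp [graphF₂]⟩
  have h1 := hp.ne_zero_of_hasPendant h01.symm h12 h02 ⟨4, by simp [graphF₂]⟩
  have h2 := hp.ne_zero_of_hasPendant h02.symm h12.symm h01 ⟨5, by simp [graphF₂]⟩
  have e01 := hp.ne_of_adj h01
  have e02 := hp.ne_of_adj h02
  have e12 := hp.ne_of_adj h12
  omega

theorem not_admitsMatrixPartition_graphF₃ : ¬ AdmitsMatrixPartition patternM₁ graphF₃ := by
  rintro ⟨p, hp⟩
  have h01 : graphF₃.Adj 0 1 := by simp [graphF₃]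
  have h02 : graphF₃.Adj 0 2 := by simp [graphF₃]
  have h12 : graphF₃.Adj 1 2 := by simp [graphF₃]
  have h1 := hp.ne_zero_of_hasPendant h01.symm h12 h02 ⟨3, by simp [graphF₃]⟩
  have h2 := hp.ne_zero_of_hasPendant h02.symm h12.symm h01 ⟨5, by simp [graphF₃]⟩
  have h4 : p 4 = 0 := by
    refine hp.eq_zero_of_not_adj h01 h02 h12 ?_ ?_ ?_ <;> simp [graphF₃]
  have h6 : p 6 = 0 := by
    refine hp.eq_zero_of_not_adj h01 h02 h12 ?_ ?_ ?_ <;> simp [graphF₃]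
  have e12 := hp.ne_of_adj h12
  have e13 := hp.ne_of_adj (u := 1) (v := 3) (by simp [graphF₃])
  have e34 := hp.ne_of_adj (u := 3) (v := 4) (by simp [graphF₃])
  have e25 := hp.ne_of_adj (u := 2) (v := 5) (by simp [graphF₃])
  have e56 := hp.ne_of_adj (u := 5) (v := 6) (by simp [graphF₃])
  -- Vertices `3` and `5` are forced into the parts of `2` and `1`, that is, into `V₂` and `V₃` in
  -- some order, yet they are not adjacent.
  have n35 := hp.of_not_adj (u := 3) (v := 5) (by simp [graphF₃])
  omega

theorem not_admitsMatrixPartition_graphF₄ : ¬ AdmitsMatrixPartition patternM₁ graphF₄ := by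
  rintro ⟨p, hp⟩
  have h01 : graphF₄.Adj 0 1 := by simp [graphF₄]
  have h02 : graphF₄.Adj 0 2 := by simp [graphF₄]
  have h12 : graphF₄.Adj 1 2 := by simp [graphF₄]
  have h1 := hp.ne_zero_of_hasPendant h01.symm h12 h02 ⟨3, by simp [graphF₄]⟩
  have h2 := hp.ne_zero_of_hasPendant h02.symm h12.symm h01 ⟨4, by simp [graphF₄]⟩
  have e01 := hp.ne_of_adj h01
  have e02 := hp.ne_of_adj h02
  have e12 := hp.ne_of_adj h12
  have e05 := hp.ne_of_adj (u := 0) (v := 5) (by simp [graphF₄])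
  have e06 := hp.ne_of_adj (u := 0) (v := 6) (by simp [graphF₄])
  have e25 := hp.ne_of_adj (u := 2) (v := 5) (by simp [graphF₄])
  have e16 := hp.ne_of_adj (u := 1) (v := 6) (by simp [graphF₄])
  have n56 := hp.of_not_adj (u := 5) (v := 6) (by simp [graphF₄])
  omega

theorem not_admitsMatrixPartition_pathWithHub {ℓ : ℕ} (hodd : Odd ℓ) (h5 : 5 ≤ ℓ) :
    ¬ AdmitsMatrixPartition patternM₁ (pathWithHub ℓ) := by
  rintro ⟨part, hp⟩
  obtain ⟨p, hpp⟩ : ∃ p : ℕ → Fin 3, ∀ i : Fin (ℓ + 1), part (some i) = p i :=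
    ⟨fun i => part (some (Fin.ofNat (ℓ + 1) i)), fun i => by simp⟩
  have hpath : ∀ i, i < ℓ → p i ≠ p (i + 1) := fun i hi => by
    have := hp.ne_of_adj ((pathWithHub_adj_some ⟨i, by omega⟩ ⟨i + 1, by omega⟩).2 (.inl rfl))
    rwa [hpp, hpp] at this
  have hhub : ∀ i, 0 < i → i < ℓ → part none ≠ p i := fun i h0 hi => by
    have := hp.ne_of_adj ((pathWithHub_adj_none (ℓ := ℓ) ⟨i, by omega⟩).2 ⟨h0, hi⟩)
    rwa [hpp] at this
  have hpath' : ∀ i j, i ≤ ℓ → j ≤ ℓ → i + 1 ≠ j → j + 1 ≠ i →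
      (p i = 1 → p j ≠ 2) ∧ (p i = 2 → p j ≠ 1) := fun i j hi hj h1 h2 => by
    have := hp.of_not_adj (u := some ⟨i, by omega⟩) (v := some ⟨j, by omega⟩)
      (fun h => ((pathWithHub_adj_some _ _).1 h).elim h1 h2)
    rwa [hpp, hpp] at this
  have hhub' : ∀ i, i ≤ ℓ → (i = 0 ∨ i = ℓ) →
      (part none = 1 → p i ≠ 2) ∧ (part none = 2 → p i ≠ 1) := fun i hi h => by
    have := hp.of_not_adj (u := none) (v := some ⟨i, by omega⟩)
      (fun h' => by have := (pathWithHub_adj_none _).1 h'; simp only at this; omega)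
    rwa [hpp] at this
  generalize part none = h at hhub hhub'
  -- With the hub in `V₁`, the vertices at positions 1 to 4 would alternate between `V₂` and `V₃`,
  -- putting the non-adjacent positions 1 and 4 in different ones. This needs `4 < ℓ`.
  have h0 : h ≠ 0 := by
    have key : ∀ a b c d : Fin 3, a ≠ 0 → b ≠ 0 → a ≠ b → b ≠ c → c ≠ 0 → c ≠ d → d ≠ 0 →
        ((a = 1 → d ≠ 2) ∧ (a = 2 → d ≠ 1)) → False := by decide
    rintro rfl
    exact key (p 1) (p 2) (p 3) (p 4) (hhub 1 (by omega) (by omega)).symm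
      (hhub 2 (by omega) (by omega)).symm (hpath 1 (by omega)) (hpath 2 (by omega))
      (hhub 3 (by omega) (by omega)).symm (hpath 3 (by omega)) (hhub 4 (by omega) (by omega)).symm
      (hpath' 1 4 (by omega) (by omega) (by omega) (by omega))
  have hend : ∀ h q x y : Fin 3, h ≠ 0 → h ≠ x → h ≠ y → x ≠ y →
      ((q = 1 → x ≠ 2) ∧ (q = 2 → x ≠ 1)) → ((q = 1 → y ≠ 2) ∧ (q = 2 → y ≠ 1)) →
      ((h = 1 → q ≠ 2) ∧ (h = 2 → q ≠ 1)) → q = 0 := by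
    intros
    omega
  -- Each end misses a triangle formed by the hub and two consecutive inner vertices, so it lies in
  -- `V₁`.
  have hends : p 0 = 0 ∧ p ℓ = 0 :=
    ⟨hend h _ (p 3) (p 4) h0 (hhub 3 (by omega) (by omega)) (hhub 4 (by omega) (by omega))
      (hpath 3 (by omega)) (hpath' 0 3 (by omega) (by omega) (by omega) (by omega))
      (hpath' 0 4 (by omega) (by omega) (by omega) (by omega)) (hhub' 0 (by omega) (.inl rfl)),
    hend h _ (p 1) (p 2) h0 (hhub 1 (by omega) (by omega)) (hhub 2 (by omega) (by omega))
      (hpath 1 (by omega)) (hpath' ℓ 1 (by omega) (by omega) (by omega) (by omega))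
      (hpath' ℓ 2 (by omega) (by omega) (by omega) (by omega)) (hhub' ℓ le_rfl (.inr rfl))⟩
  have hstep : ∀ h x y : Fin 3, h ≠ 0 → x ≠ y → h ≠ y → h ≠ x → (y = 0 ↔ ¬ x = 0) := by decide
  -- Inner vertices avoid the hub's part, so membership in `V₁` alternates from position 0. As `ℓ -
  -- 1` is even, positions `ℓ - 1` and `ℓ` are both in `V₁`.
  have halt : ∀ i, i < ℓ → (p i = 0 ↔ Even i) := by
    intro i
    induction i with
    | zero => simp [hends.1]
    | succ i ih =>
      intro hi
      rw [Nat.even_add_one, ← ih (by omega)]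
      have e1 := hpath i (by omega)
      have e2 := hhub (i + 1) (by omega) hi
      have e3 := hhub i
      have e4 := hends.1
      rcases Nat.eq_zero_or_pos i with rfl | hi0
      · simp only [e4, not_true, iff_false]
        exact fun h => e1 (e4.trans h.symm)
      · exact hstep h _ _ h0 e1 e2 (e3 hi0 (by omega))
  obtain ⟨k, hk⟩ := hodd
  refine hpath (ℓ - 1) (by omega) ?_
  rw [show ℓ - 1 + 1 = ℓ by omega, hends.2, halt _ (by omega)]
  exact ⟨k, by omega⟩

/-! ### The two implications -/

theorem isInducedFree_of_admitsMatrixPartition {V : Type*} {G : SimpleGraph V}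
    (hG : AdmitsMatrixPartition patternM₁ G) : IsInducedFree (sporadicF ∪ familyF₁) G := by
  intro H hH hle
  have h := hG.of_isIndContained hle
  rcases hH with (rfl | rfl | rfl | rfl) | ⟨ℓ, hodd, h5, rfl⟩
  · exact not_admitsMatrixPartition_graphF₁ h
  · exact not_admitsMatrixPartition_graphF₂ h
  · exact not_admitsMatrixPartition_graphF₃ h
  · exact not_admitsMatrixPartition_graphF₄ h
  · exact not_admitsMatrixPartition_pathWithHub hodd h5 h

theorem IsChordalGraph.exists_isBipartite_of_admitsMatrixPartition {V : Type*} [Nonempty V]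
    {G : SimpleGraph V} (hG : IsChordalGraph G) (hM : AdmitsMatrixPartition patternM₁ G) :
    ∃ v₀ : V, (G.induce {v₀}ᶜ).IsBipartite := by
  obtain ⟨part, hp⟩ := hM
  -- `V₂` or `V₃` has at most one vertex; otherwise two vertices of each form a 4-cycle whose chord
  -- would lie inside a part. If that part is empty, `v₀` is arbitrary.
  obtain ⟨v₀, i, hi, hv⟩ : ∃ v₀ : V, ∃ i : Fin 3, i ≠ 0 ∧ ∀ u, part u = i → u = v₀ := by
    by_contra! hne
    have v := Classical.arbitrary V
    obtain ⟨x, hx, -⟩ := hne v 1 (by decide)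
    obtain ⟨y, hy, hyx⟩ := hne x 1 (by decide)
    obtain ⟨z, hz, -⟩ := hne v 2 (by decide)
    obtain ⟨w, hw, hwz⟩ := hne z 2 (by decide)
    have hadj : ∀ u v, part u = 1 → part v = 2 → G.Adj u v := fun u v hu hv => by
      by_contra h
      exact (hp.of_not_adj h).1 hu hv
    rcases hG.chord_of_cycle_four (hadj x z hx hz) (hadj y z hy hz).symm (hadj y w hy hw)
      (hadj x w hx hw).symm hyx.symm hwz.symm with h | h
    · exact hp.ne_of_adj h (hx.trans hy.symm)
    · exact hp.ne_of_adj h (hz.trans hw.symm)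
  refine ⟨v₀, ⟨SimpleGraph.Coloring.mk (fun u => if part u = 0 then 0 else 1) ?_⟩⟩
  intro u w huw
  have h1 : part u ≠ part w := hp.ne_of_adj huw
  have h2 : part u ≠ i := fun h => u.2 (hv u h)
  have h3 : part w ≠ i := fun h => w.2 (hv w h)
  split_ifs <;> omega

theorem SimpleGraph.IsBipartite.admitsMatrixPartition {V : Type*} {G : SimpleGraph V}
    (hG : G.IsBipartite) : AdmitsMatrixPartition patternM₁ G := by
  obtain ⟨C⟩ := hG
  refine ⟨fun v => (C v).castSucc, isMatrixPartition_patternM₁_iff.2 ⟨fun u v huv => ?_, ?_⟩⟩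
  · exact fun h => C.valid huv (Fin.castSucc_injective _ h)
  · intro u v _ _
    exact Fin.castSucc_ne_last (C v)

theorem SimpleGraph.IsBipartite.coversTriangles {V : Type*} {G : SimpleGraph V} {v : V}
    (hv : (G.induce {v}ᶜ).IsBipartite) : G.CoversTriangles v := by
  intro x y z hxy hyz hzx
  by_contra! h
  obtain ⟨C⟩ := hv
  have h1 : C ⟨x, h.1.symm⟩ ≠ C ⟨y, h.2.1.symm⟩ := C.valid hxy
  have h2 : C ⟨y, h.2.1.symm⟩ ≠ C ⟨z, h.2.2.symm⟩ := C.valid hyz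
  have h3 : C ⟨z, h.2.2.symm⟩ ≠ C ⟨x, h.1.symm⟩ := C.valid hzx
  omega

theorem IsChordalGraph.admitsMatrixPartition {V : Type*} {G : SimpleGraph V}
    (hG : IsChordalGraph G) (hF : IsInducedFree (sporadicF ∪ familyF₁) G) {v₀ : V}
    (hv₀ : (G.induce {v₀}ᶜ).IsBipartite) : AdmitsMatrixPartition patternM₁ G := by
  by_contra hM
  -- Without a triangle at `v₀` there is no triangle at all, so `G` is a forest and its 2-colouring
  -- is a partition with `V₃` empty.
  obtain ⟨a, b, hva, hvb, hab⟩ : ∃ a b, G.Adj v₀ a ∧ G.Adj v₀ b ∧ G.Adj a b := by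
    by_contra! hne
    refine hM (SimpleGraph.IsAcyclic.isBipartite fun u c hc => ?_).admitsMatrixPartition
    obtain ⟨x, -, y, -, z, -, hxy, hyz, hzx⟩ := hG.exists_triangle_of_isCycle c hc
    rcases hv₀.coversTriangles x y z hxy hyz hzx with rfl | rfl | rfl
    exacts [hne _ _ hxy hzx.symm hyz, hne _ _ hxy.symm hyz hzx.symm, hne _ _ hzx hyz.symm hxy]
  refine hG.not_forall_isObstructed (hF _ (.inl (.inl rfl))) (hF _ (.inl (.inr (.inl rfl))))
    (hF _ (.inl (.inr (.inr (.inl rfl))))) (hF _ (.inl (.inr (.inr (.inr rfl)))))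
    hv₀.coversTriangles hva hvb hab fun u hu => ?_
  exact isObstructed_of_not_admits (fun H hH => hF H (.inr hH)) (hG.isBipartite_induce_compl hu) hM

theorem theorem2 {V : Type*} [Finite V] [Nonempty V] (G : SimpleGraph V)
    (hG : IsChordalGraph G) :
    AdmitsMatrixPartition patternM₁ G ↔
      IsInducedFree (sporadicF ∪ familyF₁) G ∧
        ∃ v₀ : V, (G.induce {v₀}ᶜ).IsBipartite :=
  ⟨fun h => ⟨isInducedFree_of_admitsMatrixPartition h,
    hG.exists_isBipartite_of_admitsMatrixPartition h⟩,
    fun ⟨hF, _, hv₀⟩ => hG.admitsMatrixPartition hF hv₀⟩
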